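/- Let $\Omega\subset\mathbb R^d$ ($d\ge 1$) be a bounded smooth domain, let $F:\partial\Omega\to\mathbb R$ be Lipschitz, and let $\Psi:\overline\Omega\to\mathbb R$ be a continuous obstacle with $\sup_{\partial\Omega}\Psi<\inf_{\partial\Omega}F$. For $1<p<\infty$ let $u_p$ be the minimizer of $\int_\Omega|Dv|^p\,dx$ among all $v\in W^{1,p}(\Omega)$ with trace $F$ on $\partial\Omega$ and $v\ge\Psi$ a.e. in $\Omega$. Let $u_\infty:\overline\Omega\to\mathbb R$ be a limit of these solutions, that is, the uniform limit on $\overline\Omega$, along some sequence $p_j\to\infty$, of (continuous representatives on $\overline\Omega$ of) the $u_{p_j}$. Write $\{u_\infty>\Psi\}:=\{x\in\Omega: u_\infty(x)>\Psi(x)\}$ and $\Delta_\infty\varphi:=\sum_{i,j=1}^d\partial_i\varphi\,\partial_j\varphi\,\partial_i\partial_j\varphi$. Let $\nu>0$ and assume that $$\Delta_\infty(u_\infty-\Psi)\ \ge\ \nu\quad\text{in }\{u_\infty>\Psi\}$$ in the viscosity sense: whenever $\varphi\in C^2(\mathbb R^d)$ and $u_\infty-\Psi-\varphi$ has a local maximum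 at a point $x\in\{u_\infty>\Psi\}$, one has $\Delta_\infty\varphi(x)\ge\nu$. Then there is a constant $c>0$ depending only on $\nu$ (not on $d$, $\Omega$, $F$, $\Psi$, $u_\infty$, $y_0$ or $r$) such that, for every $y_0\in\overline{\{u_\infty>\Psi\}}$ and every $r>0$ with $B_r(y_0)\subset\Omega$, $$\sup_{B_r(y_0)}|u_\infty-\Psi|\ \ge\ c\,r^{4/3}.$$ -/

import Mathlib

open MeasureTheory Filter Topology Set
open scoped ContDiff

noncomputable section

namespace InfObstacle

/-- A bounded smooth domain: non-empty, open, connected, bounded, and near each boundary point equal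
to a sublevel set of a smooth function with non-vanishing derivative. -/
structure IsBoundedSmoothDomain {d : ℕ} (Ω : Set (EuclideanSpace ℝ (Fin d))) : Prop where
  isOpen : IsOpen Ω
  isConnected : IsConnected Ω
  isBounded : Bornology.IsBounded Ω
  smooth_boundary : ∀ x ∈ frontier Ω, ∃ U ∈ 𝓝 x, ∃ ρ : EuclideanSpace ℝ (Fin d) → ℝ,
    ContDiff ℝ ∞ ρ ∧ fderiv ℝ ρ x ≠ 0 ∧ Ω ∩ U = {y | ρ y < 0} ∩ U

/-- `φ ∈ C_c^∞(Ω)`. -/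
def IsTestFunction {d : ℕ} (Ω : Set (EuclideanSpace ℝ (Fin d)))
    (φ : EuclideanSpace ℝ (Fin d) → ℝ) : Prop :=
  ContDiff ℝ ∞ φ ∧ HasCompactSupport φ ∧ tsupport φ ⊆ Ω

/-- `G` is the weak (distributional) gradient of `v` in `Ω`. -/
def HasWeakGradient {d : ℕ} (Ω : Set (EuclideanSpace ℝ (Fin d)))
    (v : EuclideanSpace ℝ (Fin d) → ℝ)
    (G : EuclideanSpace ℝ (Fin d) → EuclideanSpace ℝ (Fin d)) : Prop :=
  ∀ φ : EuclideanSpace ℝ (Fin d) → ℝ, IsTestFunction Ω φ → ∀ e : EuclideanSpace ℝ (Fin d),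
    ∫ x in Ω, v x * fderiv ℝ φ x e = - ∫ x in Ω, inner ℝ (G x) e * φ x

/-- `v ∈ W^{1,p}(Ω)`, with weak gradient `G` (for `1 < p < ∞`). -/
structure IsSobolev {d : ℕ} (Ω : Set (EuclideanSpace ℝ (Fin d))) (p : ℝ)
    (v : EuclideanSpace ℝ (Fin d) → ℝ)
    (G : EuclideanSpace ℝ (Fin d) → EuclideanSpace ℝ (Fin d)) : Prop where
  memLp : MemLp v (ENNReal.ofReal p) (volume.restrict Ω)
  memLp_gradient : MemLp G (ENNReal.ofReal p) (volume.restrict Ω)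
  hasWeakGradient : HasWeakGradient Ω v G

/-- `v ∈ W_0^{1,p}(Ω)`, the closure of `C_c^∞(Ω)` in `W^{1,p}(Ω)`. -/
def IsSobolevZero {d : ℕ} (Ω : Set (EuclideanSpace ℝ (Fin d))) (p : ℝ)
    (v : EuclideanSpace ℝ (Fin d) → ℝ) : Prop :=
  ∃ G : EuclideanSpace ℝ (Fin d) → EuclideanSpace ℝ (Fin d), IsSobolev Ω p v G ∧
    ∃ φ : ℕ → EuclideanSpace ℝ (Fin d) → ℝ, (∀ n, IsTestFunction Ω (φ n)) ∧
      Tendsto (fun n => eLpNorm (fun x => v x - φ n x) (ENNReal.ofReal p) (volume.restrict Ω))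
        atTop (𝓝 0) ∧
      Tendsto (fun n => eLpNorm (fun x => G x - gradient (φ n) x) (ENNReal.ofReal p)
        (volume.restrict Ω)) atTop (𝓝 0)

/-- `v` has trace `F` on `∂Ω`, for a Lipschitz function `F` on `∂Ω`: `v - z ∈ W_0^{1,p}(Ω)` for a
Lipschitz extension `z` of `F` (the choice of the extension does not matter). -/
def HasTrace {d : ℕ} (Ω : Set (EuclideanSpace ℝ (Fin d))) (p : ℝ)
    (F v : EuclideanSpace ℝ (Fin d) → ℝ) : Prop :=
  ∃ z : EuclideanSpace ℝ (Fin d) → ℝ, (∃ K, LipschitzWith K z) ∧ EqOn z F (frontier Ω) ∧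
    IsSobolevZero Ω p (fun x => v x - z x)

/-- `v` is a competitor in the `p`-obstacle problem (with weak gradient `G`): it belongs to
`W^{1,p}(Ω)`, has trace `F` on `∂Ω`, and lies above the obstacle `Ψ`. -/
structure IsAdmissible {d : ℕ} (Ω : Set (EuclideanSpace ℝ (Fin d)))
    (F Ψ : EuclideanSpace ℝ (Fin d) → ℝ) (p : ℝ) (v : EuclideanSpace ℝ (Fin d) → ℝ)
    (G : EuclideanSpace ℝ (Fin d) → EuclideanSpace ℝ (Fin d)) : Prop where
  isSobolev : IsSobolev Ω p v G
  hasTrace : HasTrace Ω p F v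
  above : ∀ᵐ x ∂(volume.restrict Ω), Ψ x ≤ v x

/-- `v` solves the `p`-obstacle problem: it minimizes `∫_Ω |Dv|^p` among all competitors. -/
def IsMinimizer {d : ℕ} (Ω : Set (EuclideanSpace ℝ (Fin d)))
    (F Ψ : EuclideanSpace ℝ (Fin d) → ℝ) (p : ℝ) (v : EuclideanSpace ℝ (Fin d) → ℝ) : Prop :=
  ∃ G : EuclideanSpace ℝ (Fin d) → EuclideanSpace ℝ (Fin d), IsAdmissible Ω F Ψ p v G ∧
    ∀ (w : EuclideanSpace ℝ (Fin d) → ℝ)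
      (H : EuclideanSpace ℝ (Fin d) → EuclideanSpace ℝ (Fin d)), IsAdmissible Ω F Ψ p w H →
        ∫ x in Ω, ‖G x‖ ^ p ≤ ∫ x in Ω, ‖H x‖ ^ p

/-- `u` is the solution `u_∞` of the infinity obstacle problem obtained as `p → ∞`: the uniform limit
on the (compact) closure of `Ω`, along some sequence `p_j → ∞`, of the solutions of the
`p_j`-obstacle problems, given by their representatives that are continuous on the closure. -/
def IsLimitSolution {d : ℕ} (Ω : Set (EuclideanSpace ℝ (Fin d)))
    (F Ψ u : EuclideanSpace ℝ (Fin d) → ℝ) : Prop :=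
  ∃ (p : ℕ → ℝ) (U : ℕ → EuclideanSpace ℝ (Fin d) → ℝ),
    Tendsto p atTop atTop ∧ (∀ j, 1 < p j) ∧
    (∀ j, ContinuousOn (U j) (closure Ω)) ∧ (∀ j, IsMinimizer Ω F Ψ (p j) (U j)) ∧
    TendstoUniformlyOn U u atTop (closure Ω)

/-- The non-coincidence set `{u > Ψ}` in `Ω`. -/
def noncoincidenceSet {d : ℕ} (Ω : Set (EuclideanSpace ℝ (Fin d)))
    (Ψ u : EuclideanSpace ℝ (Fin d) → ℝ) : Set (EuclideanSpace ℝ (Fin d)) :=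
  {x | x ∈ Ω ∧ Ψ x < u x}

/-- The `i`-th partial derivative. -/
def partialDeriv {d : ℕ} (i : Fin d) (φ : EuclideanSpace ℝ (Fin d) → ℝ)
    (x : EuclideanSpace ℝ (Fin d)) : ℝ :=
  fderiv ℝ φ x (EuclideanSpace.single i 1)

/-- The infinity Laplacian of a `C²` function, `Δ_∞ φ = ∑_{i,j} ∂_i φ ∂_j φ ∂_i ∂_j φ`. -/
def infLaplacian {d : ℕ} (φ : EuclideanSpace ℝ (Fin d) → ℝ)
    (x : EuclideanSpace ℝ (Fin d)) : ℝ :=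
  ∑ i : Fin d, ∑ j : Fin d,
    partialDeriv i φ x * partialDeriv j φ x * partialDeriv i (partialDeriv j φ) x

/-- `Δ_∞ w ≥ ν` in the open set `V` in the viscosity sense: every `C²` function that touches the
continuous function `w` from above at a point `x` of `V` (up to a constant) has infinity Laplacian at
least `ν` at `x`. -/
def ViscosityInfLaplacianGE {d : ℕ} (V : Set (EuclideanSpace ℝ (Fin d)))
    (w : EuclideanSpace ℝ (Fin d) → ℝ) (ν : ℝ) : Prop :=
  ∀ φ : EuclideanSpace ℝ (Fin d) → ℝ, ContDiff ℝ 2 φ → ∀ x ∈ V,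
    IsLocalMax (fun y => w y - φ y) x → ν ≤ infLaplacian φ x

end InfObstacle

end

open Metric

namespace InfObstacle

variable {d : ℕ}

/-! The function `c‖x - y‖^{4/3}` has constant infinity Laplacian `(64/81)c³` away from `y`, so for
small `c` it is a barrier against `w = u - Ψ`. If `w y > 0` and `w ≤ c s^{4/3}` on the closed ball
of radius `s` about `y`, then `w` minus a smoothed barrier has a positive interior maximum. There `w
> 0`, so the viscosity inequality applies and contradicts `infLaplacian_barrier_le`. This is
`exists_growth_of_viscosityInfLaplacianGE`; points `y₀` of the closure follow by approximation. From
the limit `p → ∞` only the continuity of `u` is used. -/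

/-- The quadratic function `x ↦ ‖x - y‖² + δ`. -/
noncomputable def shiftedSq (y : EuclideanSpace ℝ (Fin d)) (δ : ℝ) (x : EuclideanSpace ℝ (Fin d)) : ℝ :=
  ‖x - y‖ ^ 2 + δ

lemma shiftedSq_pos (y : EuclideanSpace ℝ (Fin d)) {δ : ℝ} (hδ : 0 < δ)
    (x : EuclideanSpace ℝ (Fin d)) : 0 < shiftedSq y δ x := by
  unfold shiftedSq; positivity

lemma contDiff_shiftedSq (y : EuclideanSpace ℝ (Fin d)) (δ : ℝ) {n : WithTop ℕ∞} :
    ContDiff ℝ n (shiftedSq y δ) :=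
  ((contDiff_id.sub contDiff_const).norm_sq ℝ).add contDiff_const

lemma hasFDerivAt_shiftedSq (y : EuclideanSpace ℝ (Fin d)) (δ : ℝ)
    (x : EuclideanSpace ℝ (Fin d)) :
    HasFDerivAt (shiftedSq y δ) (2 • innerSL ℝ (x - y)) x := by
  have h : HasFDerivAt (shiftedSq y δ) _ x :=
    (((hasFDerivAt_id x).sub_const y).norm_sq).add_const δ
  simpa using h

lemma partialDeriv_comp_shiftedSq (y : EuclideanSpace ℝ (Fin d)) (δ : ℝ) {h : ℝ → ℝ} {h' : ℝ}
    (x : EuclideanSpace ℝ (Fin d)) (hh : HasDerivAt h h' (shiftedSq y δ x)) (i : Fin d) :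
    partialDeriv i (fun x => h (shiftedSq y δ x)) x = 2 * h' * (x i - y i) := by
  have H := hh.comp_hasFDerivAt x (hasFDerivAt_shiftedSq y δ x)
  have H' : HasFDerivAt (fun x => h (shiftedSq y δ x)) _ x := H
  rw [partialDeriv, H'.fderiv]
  simp [EuclideanSpace.inner_single_right]
  ring

/-- The infinity Laplacian of the radial function `h (‖x - y‖² + δ)`. -/
lemma infLaplacian_comp_shiftedSq (y : EuclideanSpace ℝ (Fin d)) {δ : ℝ} (hδ : 0 < δ)
    {h h' h'' : ℝ → ℝ} (hh : ∀ t, 0 < t → HasDerivAt h (h' t) t)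
    (hh' : ∀ t, 0 < t → HasDerivAt h' (h'' t) t) (x : EuclideanSpace ℝ (Fin d)) :
    infLaplacian (fun x => h (shiftedSq y δ x)) x =
      16 * h' (shiftedSq y δ x) ^ 2 * h'' (shiftedSq y δ x) * (‖x - y‖ ^ 2) ^ 2 +
        8 * h' (shiftedSq y δ x) ^ 3 * ‖x - y‖ ^ 2 := by
  have h1 : ∀ j : Fin d, partialDeriv j (fun x => h (shiftedSq y δ x)) =
      fun x => 2 * h' (shiftedSq y δ x) * (x j - y j) := fun j => by
    ext z
    exact partialDeriv_comp_shiftedSq y δ z (hh _ (shiftedSq_pos y hδ z)) j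
  have h2 : ∀ i j : Fin d,
      partialDeriv i (fun x => 2 * h' (shiftedSq y δ x) * (x j - y j)) x =
        4 * h'' (shiftedSq y δ x) * (x i - y i) * (x j - y j) +
          if i = j then 2 * h' (shiftedSq y δ x) else 0 := fun i j => by
    have A : HasFDerivAt (fun x => h' (shiftedSq y δ x)) _ x :=
      (hh' _ (shiftedSq_pos y hδ x)).comp_hasFDerivAt x (hasFDerivAt_shiftedSq y δ x)
    have B : HasFDerivAt (fun x : EuclideanSpace ℝ (Fin d) => x j - y j)
        (EuclideanSpace.proj j : EuclideanSpace ℝ (Fin d) →L[ℝ] ℝ) x :=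
      (EuclideanSpace.proj j : EuclideanSpace ℝ (Fin d) →L[ℝ] ℝ).hasFDerivAt.sub_const (y j)
    have C : HasFDerivAt (fun x => 2 * h' (shiftedSq y δ x) * (x j - y j)) _ x :=
      (A.const_mul 2).mul B
    rw [partialDeriv, C.fderiv]
    by_cases hij : i = j
    · subst hij
      simp [EuclideanSpace.inner_single_right]
      ring
    · simp [EuclideanSpace.inner_single_right, hij, Ne.symm hij]
      ring
  have h3 : ‖x - y‖ ^ 2 = ∑ i : Fin d, (x i - y i) ^ 2 := by
    simp [EuclideanSpace.norm_sq_eq]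
  unfold infLaplacian
  simp only [h1, h2, mul_add, Finset.sum_add_distrib, mul_ite, mul_zero, Finset.sum_ite_eq,
    Finset.mem_univ, if_true]
  rw [h3]
  congr 1
  · rw [sq (∑ i : Fin d, (x i - y i) ^ 2), Finset.sum_mul_sum, Finset.mul_sum]
    refine Finset.sum_congr rfl fun i _ => ?_
    rw [Finset.mul_sum]
    exact Finset.sum_congr rfl fun j _ => by ring
  · rw [Finset.mul_sum]
    exact Finset.sum_congr rfl fun i _ => by ring

/-- The smoothed barrier `c (‖x - y‖² + δ)^{2/3}` has infinity Laplacian at most `(64/27) c³`. -/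
lemma infLaplacian_barrier_le (y : EuclideanSpace ℝ (Fin d)) {δ c : ℝ} (hδ : 0 < δ) (hc : 0 < c)
    (x : EuclideanSpace ℝ (Fin d)) :
    infLaplacian (fun x => c * shiftedSq y δ x ^ (2 / 3 : ℝ)) x ≤ 64 / 27 * c ^ 3 := by
  have hh : ∀ t : ℝ, 0 < t →
      HasDerivAt (fun t : ℝ => c * t ^ (2 / 3 : ℝ)) (c * (2 / 3 * t ^ (-1 / 3 : ℝ))) t :=
    fun t ht => by
      have h := (Real.hasDerivAt_rpow_const (p := 2 / 3) (Or.inl ht.ne')).const_mul c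
      rwa [show (2 / 3 - 1 : ℝ) = -1 / 3 by norm_num] at h
  have hh' : ∀ t : ℝ, 0 < t →
      HasDerivAt (fun t : ℝ => c * (2 / 3 * t ^ (-1 / 3 : ℝ)))
        (c * (2 / 3 * (-1 / 3 * t ^ (-4 / 3 : ℝ)))) t :=
    fun t ht => by
      have h := ((Real.hasDerivAt_rpow_const (p := -1 / 3) (Or.inl ht.ne')).const_mul
        (2 / 3)).const_mul c
      rwa [show (-1 / 3 - 1 : ℝ) = -4 / 3 by norm_num] at h
  rw [infLaplacian_comp_shiftedSq y hδ hh hh' x]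
  have hT := shiftedSq_pos y hδ x
  have hle : ‖x - y‖ ^ 2 ≤ shiftedSq y δ x := by unfold shiftedSq; linarith
  set T := shiftedSq y δ x
  have ha : (T ^ (-1 / 3 : ℝ)) ^ 3 = T⁻¹ := by
    rw [← Real.rpow_natCast, ← Real.rpow_mul hT.le, ← Real.rpow_neg_one]
    norm_num
  -- The profile `c t^{2/3}` is concave, so its second-derivative term has a sign and can be
  -- dropped. This costs a factor 3 against `64/81` but gives a bound uniform in `δ`.
  have h1 : 16 * (c * (2 / 3 * T ^ (-1 / 3 : ℝ))) ^ 2 *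
      (c * (2 / 3 * (-1 / 3 * T ^ (-4 / 3 : ℝ)))) * (‖x - y‖ ^ 2) ^ 2 ≤ 0 := by
    have : 0 ≤ 16 * (c * (2 / 3 * T ^ (-1 / 3 : ℝ))) ^ 2 *
      (c * (2 / 3 * (1 / 3 * T ^ (-4 / 3 : ℝ)))) * (‖x - y‖ ^ 2) ^ 2 := by positivity
    linarith
  have h2 : 8 * (c * (2 / 3 * T ^ (-1 / 3 : ℝ))) ^ 3 * ‖x - y‖ ^ 2 =
      64 / 27 * c ^ 3 * (T⁻¹ * ‖x - y‖ ^ 2) := by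
    rw [← ha]; ring
  have h3 : T⁻¹ * ‖x - y‖ ^ 2 ≤ 1 := by
    rw [inv_mul_le_iff₀ hT]; linarith
  have h4 : 64 / 27 * c ^ 3 * (T⁻¹ * ‖x - y‖ ^ 2) ≤ 64 / 27 * c ^ 3 * 1 := by gcongr
  linarith

lemma contDiff_barrier (y : EuclideanSpace ℝ (Fin d)) {δ : ℝ} (hδ : 0 < δ) (c : ℝ) :
    ContDiff ℝ 2 (fun x => c * shiftedSq y δ x ^ (2 / 3 : ℝ)) :=
  contDiff_const.mul ((contDiff_shiftedSq y δ).rpow_const_of_ne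
    fun x => (shiftedSq_pos y hδ x).ne')

/-- Growth from a point of positivity, for functions with `Δ_∞ w ≥ ν` where they are positive. -/
lemma exists_growth_of_viscosityInfLaplacianGE {V : Set (EuclideanSpace ℝ (Fin d))}
    {w : EuclideanSpace ℝ (Fin d) → ℝ} {ν c s : ℝ} (hc : 0 < c) (hcν : 64 / 27 * c ^ 3 < ν)
    (hs : 0 < s) {y : EuclideanSpace ℝ (Fin d)} (hw : ContinuousOn w (closedBall y s))
    (hV : ∀ x ∈ closedBall y s, 0 < w x → x ∈ V) (hy : 0 < w y)
    (hvisc : ViscosityInfLaplacianGE V w ν) :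
    ∃ x ∈ closedBall y s, c * s ^ (4 / 3 : ℝ) < w x := by
  by_contra! hsmall
  -- The shift `δ` makes the barrier `C²` at `y`; it is taken so small that the barrier at `y`,
  -- which is `c δ^{2/3}`, stays below `w y`.
  have hlim : Tendsto (fun δ : ℝ => c * δ ^ (2 / 3 : ℝ)) (𝓝[>] 0) (𝓝 0) := by
    have : ContinuousAt (fun δ : ℝ => c * δ ^ (2 / 3 : ℝ)) 0 :=
      continuousAt_const.mul (Real.continuousAt_rpow_const _ _ (Or.inr (by norm_num)))
    have h0 := this.tendsto.mono_left (nhdsWithin_le_nhds (s := Ioi 0))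
    simpa [Real.zero_rpow] using h0
  obtain ⟨δ, hδw, hδ⟩ := ((hlim.eventually_lt_const hy).and self_mem_nhdsWithin).exists
  have hδ : 0 < δ := hδ
  set φ : EuclideanSpace ℝ (Fin d) → ℝ := fun x => c * shiftedSq y δ x ^ (2 / 3 : ℝ) with hφ
  have hφC : ContDiff ℝ 2 φ := contDiff_barrier y hδ c
  have hφpos : ∀ x, 0 < φ x := fun x =>
    mul_pos hc (Real.rpow_pos_of_pos (shiftedSq_pos y hδ x) _)
  obtain ⟨x, hx, hmax⟩ := (isCompact_closedBall y s).exists_isMaxOn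
    ⟨y, mem_closedBall_self hs.le⟩ (hw.sub hφC.continuous.continuousOn)
  have hxpos : 0 < w x - φ x := by
    have h1 : w y - φ y ≤ w x - φ x := hmax (mem_closedBall_self hs.le)
    have h2 : φ y = c * δ ^ (2 / 3 : ℝ) := by simp [hφ, shiftedSq]
    linarith
  -- On the sphere the barrier is at least `c s^{4/3} ≥ w`, which excludes a positive maximum there.
  have hxball : x ∈ ball y s := by
    by_contra hxs
    have hsx : s ≤ ‖x - y‖ := by
      rw [mem_ball, not_lt, dist_eq_norm] at hxs
      exact hxs
    have h1 : s ^ (4 / 3 : ℝ) ≤ shiftedSq y δ x ^ (2 / 3 : ℝ) := by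
      have : s ^ (4 / 3 : ℝ) = (s ^ 2) ^ (2 / 3 : ℝ) := by
        rw [← Real.rpow_natCast, ← Real.rpow_mul hs.le]
        norm_num
      rw [this]
      refine Real.rpow_le_rpow (by positivity) ?_ (by norm_num)
      have : s ^ 2 ≤ ‖x - y‖ ^ 2 := by gcongr
      unfold shiftedSq
      linarith
    have h2 : c * s ^ (4 / 3 : ℝ) ≤ φ x := mul_le_mul_of_nonneg_left h1 hc.le
    linarith [hsmall x hx]
  have hloc : IsLocalMax (fun z => w z - φ z) x :=
    hmax.isLocalMax (mem_of_superset (isOpen_ball.mem_nhds hxball) ball_subset_closedBall)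
  have h1 := hvisc φ hφC x (hV x hx (by linarith [hφpos x])) hloc
  linarith [infLaplacian_barrier_le y hδ hc x]

lemma IsLimitSolution.continuousOn {Ω : Set (EuclideanSpace ℝ (Fin d))}
    {F Ψ u : EuclideanSpace ℝ (Fin d) → ℝ} (h : IsLimitSolution Ω F Ψ u) :
    ContinuousOn u (closure Ω) := by
  obtain ⟨p, U, -, -, hU, -, hlim⟩ := h
  exact hlim.continuousOn (Eventually.of_forall hU).frequently

end InfObstacle

open InfObstacle in
theorem theorem4p3 (ν : ℝ) (hν : 0 < ν) :
    ∃ c : ℝ, 0 < c ∧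
      ∀ (d : ℕ) (Ω : Set (EuclideanSpace ℝ (Fin d))) (F Ψ u : EuclideanSpace ℝ (Fin d) → ℝ),
        InfObstacle.IsBoundedSmoothDomain Ω →
        (∃ K, LipschitzOnWith K F (frontier Ω)) →
        ContinuousOn Ψ (closure Ω) →
        sSup (Ψ '' frontier Ω) < sInf (F '' frontier Ω) →
        InfObstacle.IsLimitSolution Ω F Ψ u →
        InfObstacle.ViscosityInfLaplacianGE (InfObstacle.noncoincidenceSet Ω Ψ u)
          (fun x => u x - Ψ x) ν →
        ∀ y₀ ∈ closure (InfObstacle.noncoincidenceSet Ω Ψ u), ∀ r : ℝ, 0 < r →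
          Metric.ball y₀ r ⊆ Ω →
          c * r ^ (4 / 3 : ℝ) ≤ sSup ((fun x => |u x - Ψ x|) '' Metric.ball y₀ r) := by
  have hc : 0 < (ν / 4) ^ (1 / 3 : ℝ) := Real.rpow_pos_of_pos (by linarith) _
  have hc3 : ((ν / 4) ^ (1 / 3 : ℝ)) ^ 3 = ν / 4 := by
    rw [← Real.rpow_natCast, ← Real.rpow_mul (by linarith)]
    norm_num
  -- With `c³ = ν/4` the barrier bound is `(16/27)ν < ν`.
  refine ⟨(ν / 4) ^ (1 / 3 : ℝ), hc, ?_⟩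
  generalize (ν / 4) ^ (1 / 3 : ℝ) = c at hc hc3
  intro d Ω F Ψ u hΩ _ hΨ _ hu hvisc y₀ hy₀ r hr hball
  have hw : ContinuousOn (fun x => u x - Ψ x) (closure Ω) := hu.continuousOn.sub hΨ
  -- Without boundedness the real `sSup` would take its default value 0.
  have hbdd : BddAbove ((fun x => |u x - Ψ x|) '' ball y₀ r) :=
    (hΩ.isBounded.isCompact_closure.bddAbove_image hw.abs).mono
      (image_mono (hball.trans subset_closure))
  -- Positivity may fail at `y₀` itself: radius `s < r` leaves room to recentre at a nearby `y` with
  -- `w y > 0`, and then `s → r`.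
  have key : ∀ s ∈ Ioo 0 r,
      c * s ^ (4 / 3 : ℝ) ≤ sSup ((fun x => |u x - Ψ x|) '' ball y₀ r) := by
    rintro s ⟨hs, hsr⟩
    obtain ⟨y, hy, hdist⟩ := Metric.mem_closure_iff.1 hy₀ (r - s) (by linarith)
    have hsub : closedBall y s ⊆ ball y₀ r :=
      closedBall_subset_ball' (by rw [dist_comm]; linarith)
    obtain ⟨x, hx, hlt⟩ := exists_growth_of_viscosityInfLaplacianGE
      (V := noncoincidenceSet Ω Ψ u) (w := fun x => u x - Ψ x) hc (by linarith) hs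
      (hw.mono ((hsub.trans hball).trans subset_closure))
      (fun x hx hpos => ⟨hball (hsub hx), sub_pos.1 hpos⟩) (sub_pos.2 hy.2) hvisc
    exact hlt.le.trans ((le_abs_self _).trans (le_csSup hbdd (mem_image_of_mem _ (hsub hx))))
  have hcont : ContinuousAt (fun s : ℝ => c * s ^ (4 / 3 : ℝ)) r :=
    continuousAt_const.mul (Real.continuousAt_rpow_const _ _ (Or.inl hr.ne'))
  exact le_of_tendsto (hcont.tendsto.mono_left nhdsWithin_le_nhds)
    (mem_of_superset (Ioo_mem_nhdsLT hr) key)
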